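/- Let $\lambda>0$. On $L^2(\mathbb{R})$ consider the unitary Fourier transform $F$, $(F\psi)(k)=(2\pi)^{-1/2}\int_{\mathbb{R}}e^{-ikx}\psi(x)\,dx$ for $\psi\in L^1\cap L^2$, the unitary involution $(I\psi)(x)=\frac1x\psi\left(\frac1x\right)$, the translation $(S_\lambda\psi)(x)=\psi\left(x-\frac1\lambda\right)$, and the unitary operators $B:=F^*IF$ and $B_\lambda:=S_\lambda^*B$. For $\theta\in\mathbb{R}$ let $\eta_\theta(x)=e^{-|x|}e^{i\,\mathrm{sgn}(x)\theta/2}$, with $\mathrm{sgn}(0)=0$. Let $\mathrm{ker}$ and $\mathrm{kei}$ be the irregular Kelvin functions of order $0$, that is, $\mathrm{ker}(x)+i\,\mathrm{kei}(x)=K_0(xe^{i\pi/4})$ for $x>0$, where $K_0(z)=\int_0^\infty e^{-z\cosh t}\,dt$ for $\mathrm{Re}\,z>0$, and $\mathrm{kei}(0)=-\pi/4$. Put $$\kappa_0:=-i\,B_\lambda F^*\eta_0,\qquad \kappa_1:=-i\,B_\lambda F^*\eta_\pi .$$ Then, for almost every $x\in\mathbb{R}$, $$\kappa_0(x)=-\sqrt{\frac8\pi}\;\mathrm{sgn}\left(x+\frac1\lambda\right)\mathrm{kei}\left(2\sqrt{\left|x+\frac1\lambda\right|}\right),\qquad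 \kappa_1(x)=\sqrt{\frac8\pi}\;\mathrm{ker}\left(2\sqrt{\left|x+\frac1\lambda\right|}\right).$$ -/

import Mathlib

open MeasureTheory

/-- The Hilbert space `L²(ℝ)` of complex-valued functions. -/
abbrev L2R : Type := Lp ℂ 2 (volume : Measure ℝ)

section WeightedComposition

/-- If the density `|w|²` is pushed forward to Lebesgue measure by `g`, then
`ψ ↦ w · (ψ ∘ g)` preserves square integrability and the `L²` norm. -/
theorem eLpNorm_weightedComp {w g : ℝ → ℝ} (hw : Measurable w)
    (hmp : MeasurePreserving g
      (volume.withDensity fun x => ENNReal.ofReal (w x ^ 2)) volume)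
    {f : ℝ → ℂ} (hf : AEStronglyMeasurable f volume) :
    eLpNorm (fun x => (w x : ℂ) * f (g x)) 2 volume = eLpNorm f 2 volume := by
  rw [← eLpNorm_comp_measurePreserving hf hmp]
  rw [eLpNorm_eq_lintegral_rpow_enorm_toReal (by norm_num) (by norm_num),
    eLpNorm_eq_lintegral_rpow_enorm_toReal (by norm_num) (by norm_num)]
  congr 1
  rw [lintegral_withDensity_eq_lintegral_mul_non_measurable _ (by fun_prop)
    (Filter.Eventually.of_forall fun x => ENNReal.ofReal_lt_top)]
  refine lintegral_congr fun x => ?_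
  simp only [Pi.mul_apply, Function.comp, enorm_mul, ENNReal.toReal_ofNat]
  rw [ENNReal.mul_rpow_of_nonneg _ _ (by norm_num)]
  congr 1
  rw [← ofReal_norm, Complex.norm_real, Real.norm_eq_abs,
    ENNReal.ofReal_rpow_of_nonneg (abs_nonneg _) (by norm_num)]
  congr 1
  rw [show (2 : ℝ) = ((2 : ℕ) : ℝ) by norm_num, Real.rpow_natCast, sq_abs]

theorem quasiMeasurePreserving_of_weight {w g : ℝ → ℝ} (hw : Measurable w)
    (hw0 : ∀ᵐ x, w x ≠ 0)
    (hmp : MeasurePreserving g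
      (volume.withDensity fun x => ENNReal.ofReal (w x ^ 2)) volume) :
    Measure.QuasiMeasurePreserving g volume volume := by
  refine hmp.quasiMeasurePreserving.mono_left ?_
  refine withDensity_absolutelyContinuous' (by fun_prop) ?_
  filter_upwards [hw0] with x hx
  have : 0 < w x ^ 2 := by positivity
  exact (ENNReal.ofReal_pos.2 this).ne'

theorem memLp_weightedComp {w g : ℝ → ℝ} (hw : Measurable w) (hw0 : ∀ᵐ x, w x ≠ 0)
    (hmp : MeasurePreserving g
      (volume.withDensity fun x => ENNReal.ofReal (w x ^ 2)) volume) (ψ : L2R) :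
    MemLp (fun x => (w x : ℂ) * ψ (g x)) 2 volume :=
  ⟨(Complex.measurable_ofReal.comp hw).aestronglyMeasurable.mul
    ((Lp.aestronglyMeasurable ψ).comp_quasiMeasurePreserving
      (quasiMeasurePreserving_of_weight hw hw0 hmp)),
    (eLpNorm_weightedComp hw hmp (Lp.aestronglyMeasurable ψ)).trans_lt (Lp.eLpNorm_lt_top ψ)⟩

/-- The isometry `(Wψ)(x) = w(x) ψ(g(x))` of `L²(ℝ)`, for a measurable weight `w`, almost everywhere
non-zero, such that `g` pushes `|w|² dx` forward to `dx`. -/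
noncomputable def weightedComp (w g : ℝ → ℝ) (hw : Measurable w) (hw0 : ∀ᵐ x, w x ≠ 0)
    (hmp : MeasurePreserving g
      (volume.withDensity fun x => ENNReal.ofReal (w x ^ 2)) volume) :
    L2R →ₗᵢ[ℂ] L2R where
  toFun ψ := (memLp_weightedComp hw hw0 hmp ψ).toLp (fun x => (w x : ℂ) * ψ (g x))
  map_add' ψ φ := by
    rw [← MemLp.toLp_add, MemLp.toLp_eq_toLp_iff]
    have h := (quasiMeasurePreserving_of_weight hw hw0 hmp).ae (Lp.coeFn_add ψ φ)
    filter_upwards [h] with x hx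
    simp only [Pi.add_apply] at hx ⊢
    rw [hx]; ring
  map_smul' c ψ := by
    rw [RingHom.id_apply, ← MemLp.toLp_const_smul, MemLp.toLp_eq_toLp_iff]
    have h := (quasiMeasurePreserving_of_weight hw hw0 hmp).ae (Lp.coeFn_smul c ψ)
    filter_upwards [h] with x hx
    simp only [Pi.smul_apply, smul_eq_mul] at hx ⊢
    rw [hx]; ring
  norm_map' ψ := by
    change ‖(memLp_weightedComp hw hw0 hmp ψ).toLp (fun x => (w x : ℂ) * ψ (g x))‖ = ‖ψ‖
    rw [Lp.norm_toLp, eLpNorm_weightedComp hw hmp (Lp.aestronglyMeasurable ψ), Lp.norm_def]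

theorem coeFn_weightedComp (w g : ℝ → ℝ) (hw : Measurable w) (hw0 : ∀ᵐ x, w x ≠ 0)
    (hmp : MeasurePreserving g
      (volume.withDensity fun x => ENNReal.ofReal (w x ^ 2)) volume) (ψ : L2R) :
    weightedComp w g hw hw0 hmp ψ =ᵐ[volume] fun x => (w x : ℂ) * ψ (g x) :=
  (memLp_weightedComp hw hw0 hmp ψ).coeFn_toLp

/-- Two weighted compositions that are inverse to each other almost everywhere form a unitary. -/
noncomputable def weightedCompEquiv (w g w' g' : ℝ → ℝ) (hw : Measurable w) (hw0 : ∀ᵐ x, w x ≠ 0)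
    (hmp : MeasurePreserving g
      (volume.withDensity fun x => ENNReal.ofReal (w x ^ 2)) volume)
    (hw' : Measurable w') (hw0' : ∀ᵐ x, w' x ≠ 0)
    (hmp' : MeasurePreserving g'
      (volume.withDensity fun x => ENNReal.ofReal (w' x ^ 2)) volume)
    (hinv : ∀ᵐ x, g' (g x) = x ∧ w x * w' (g x) = 1) :
    L2R ≃ₗᵢ[ℂ] L2R :=
  LinearIsometryEquiv.ofSurjective (weightedComp w g hw hw0 hmp) fun ψ => by
    refine ⟨weightedComp w' g' hw' hw0' hmp' ψ, ?_⟩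
    apply Lp.ext
    have h := (quasiMeasurePreserving_of_weight hw hw0 hmp).ae
      (coeFn_weightedComp w' g' hw' hw0' hmp' ψ)
    filter_upwards [coeFn_weightedComp w g hw hw0 hmp (weightedComp w' g' hw' hw0' hmp' ψ), h, hinv]
      with x h1 h2 h3
    rw [h1, h2, h3.1, ← mul_assoc, ← Complex.ofReal_mul, h3.2]
    simp

end WeightedComposition

theorem measurePreserving_dilation {a : ℝ} (ha : 0 < a) :
    MeasurePreserving (fun x : ℝ => a * x)
      (volume.withDensity fun _ => ENNReal.ofReal (√a ^ 2)) volume := by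
  refine ⟨by fun_prop, ?_⟩
  rw [withDensity_const, Measure.map_smul, Real.map_volume_mul_left ha.ne', smul_smul,
    Real.sq_sqrt ha.le, abs_of_pos (inv_pos.2 ha), ← ENNReal.ofReal_mul ha.le,
    mul_inv_cancel₀ ha.ne']
  simp

/-- The unitary dilation `(D_a ψ)(x) = √a ψ(a x)` of `L²(ℝ)`, for `a > 0`. -/
noncomputable def dilationL2 (a : ℝ) (ha : 0 < a) : L2R ≃ₗᵢ[ℂ] L2R :=
  weightedCompEquiv (fun _ => √a) (fun x => a * x) (fun _ => √(a⁻¹)) (fun x => a⁻¹ * x)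
    (by fun_prop) (Filter.Eventually.of_forall fun _ => (Real.sqrt_pos.2 ha).ne')
    (measurePreserving_dilation ha)
    (by fun_prop) (Filter.Eventually.of_forall fun _ => (Real.sqrt_pos.2 (inv_pos.2 ha)).ne')
    (measurePreserving_dilation (inv_pos.2 ha))
    (Filter.Eventually.of_forall fun x => ⟨by field_simp, by
      rw [← Real.sqrt_mul ha.le, mul_inv_cancel₀ ha.ne', Real.sqrt_one]⟩)

theorem measurePreserving_inversion :
    MeasurePreserving (fun x : ℝ => x⁻¹)
      (volume.withDensity fun x => ENNReal.ofReal (x⁻¹ ^ 2)) volume := by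
  refine ⟨by fun_prop, ?_⟩
  ext s hs
  rw [Measure.map_apply (by fun_prop) hs,
    withDensity_apply _ ((by fun_prop : Measurable fun x : ℝ => x⁻¹) hs)]
  have h0 : ∀ t : Set ℝ, (t \ {0} : Set ℝ) =ᵐ[volume] t := fun t =>
    sdiff_null_ae_eq_self (by simp)
  rw [← setLIntegral_congr (h0 _), ← measure_congr (h0 s)]
  have himg : (fun x : ℝ => x⁻¹) '' (((fun x : ℝ => x⁻¹) ⁻¹' s) \ {0}) = s \ {0} := by
    ext y
    constructor
    · rintro ⟨x, ⟨hx, hx0⟩, rfl⟩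
      exact ⟨hx, by simpa using hx0⟩
    · rintro ⟨hy, hy0⟩
      exact ⟨y⁻¹, ⟨by simpa using hy, by simpa using hy0⟩, by simp⟩
  have key := lintegral_image_eq_lintegral_abs_deriv_mul (f := fun x : ℝ => x⁻¹)
    (f' := fun x => -(x ^ 2)⁻¹)
    (s := ((fun x : ℝ => x⁻¹) ⁻¹' s) \ {0})
    (((by fun_prop : Measurable fun x : ℝ => x⁻¹) hs).diff (measurableSet_singleton 0))
    (fun x hx => (hasDerivAt_inv hx.2).hasDerivWithinAt)
    (inv_injective.injOn) (fun _ => 1)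
  rw [himg] at key
  simp only [lintegral_const, Measure.restrict_apply, MeasurableSet.univ, Set.univ_inter,
    one_mul, mul_one, abs_neg, abs_inv, abs_pow, sq_abs] at key
  rw [key]
  simp only [inv_pow]

/-- The unitary involution `(Iψ)(x) = x⁻¹ ψ(x⁻¹)` of `L²(ℝ)`. -/
noncomputable def inversionL2 : L2R ≃ₗᵢ[ℂ] L2R :=
  weightedCompEquiv (fun x => x⁻¹) (fun x => x⁻¹) (fun x => x⁻¹) (fun x => x⁻¹)
    (by fun_prop) (by filter_upwards [Measure.ae_ne volume (0 : ℝ)] with x hx using inv_ne_zero hx)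
    measurePreserving_inversion
    (by fun_prop) (by filter_upwards [Measure.ae_ne volume (0 : ℝ)] with x hx using inv_ne_zero hx)
    measurePreserving_inversion
    (by
      filter_upwards [Measure.ae_ne volume (0 : ℝ)] with x hx
      exact ⟨inv_inv x, mul_inv_cancel₀ (inv_ne_zero hx)⟩)

theorem measurePreserving_translation (b : ℝ) :
    MeasurePreserving (fun x : ℝ => x - b)
      (volume.withDensity fun _ => ENNReal.ofReal ((1 : ℝ) ^ 2)) volume := by
  simpa using measurePreserving_sub_right (volume : Measure ℝ) b

/-- The unitary translation `(S_λ ψ)(x) = ψ(x - 1/λ)` of `L²(ℝ)`. -/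
noncomputable def translationL2 (lam : ℝ) : L2R ≃ₗᵢ[ℂ] L2R :=
  weightedCompEquiv (fun _ => 1) (fun x => x - 1 / lam) (fun _ => 1) (fun x => x - -(1 / lam))
    (by fun_prop) (by simp) (measurePreserving_translation _)
    (by fun_prop) (by simp) (measurePreserving_translation _)
    (by simp)

/-- The unitary Fourier transform of `L²(ℝ)` normalized so that
`(Fψ)(k) = (2π)^{-1/2} ∫ e^{-ikx} ψ(x) dx` for `ψ ∈ L¹ ∩ L²`. Mathlib's transform has the kernel
`e^{-2πikx}`, so that `(Fψ)(k) = (2π)^{-1/2} (𝓕ψ)(k/(2π))`.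
As `F` is unitary, its adjoint is `fourierL2.symm`. -/
noncomputable def fourierL2 : L2R ≃ₗᵢ[ℂ] L2R :=
  (Lp.fourierTransformₗᵢ ℝ ℂ).trans (dilationL2 (2 * Real.pi)⁻¹ (by positivity))

/-- The unitary operator `B = F^* I F`. -/
noncomputable def opB : L2R ≃ₗᵢ[ℂ] L2R :=
  (fourierL2.trans inversionL2).trans fourierL2.symm

/-- The unitary operator `B_λ = S_λ^* B`. -/
noncomputable def opBlam (lam : ℝ) : L2R ≃ₗᵢ[ℂ] L2R :=
  opB.trans (translationL2 lam).symm

/-- The function `η_θ(x) = e^{-|x|} e^{i sgn(x) θ/2}`. -/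
noncomputable def etaFun (θ : ℝ) (x : ℝ) : ℂ :=
  Complex.exp (-(|x| : ℝ)) * Complex.exp (Complex.I * (Real.sign x : ℝ) * ((θ / 2 : ℝ) : ℂ))

theorem measurable_real_sign : Measurable Real.sign := by
  unfold Real.sign
  exact Measurable.ite measurableSet_Iio measurable_const
    (Measurable.ite measurableSet_Ioi measurable_const measurable_const)

theorem norm_etaFun (θ x : ℝ) : ‖etaFun θ x‖ = Real.exp (-|x|) := by
  unfold etaFun
  rw [norm_mul, Complex.norm_exp, Complex.norm_exp]
  simp

theorem memLp_etaFun (θ : ℝ) : MemLp (etaFun θ) 2 volume := by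
  have hm : Measurable (etaFun θ) := by
    have := measurable_real_sign
    unfold etaFun
    fun_prop
  rw [memLp_two_iff_integrable_sq_norm hm.aestronglyMeasurable]
  simp only [norm_etaFun, ← Real.exp_nat_mul]
  rw [← integrableOn_univ, ← Set.Iic_union_Ioi (a := (0 : ℝ))]
  refine IntegrableOn.union ?_ ?_
  · refine (integrableOn_exp_mul_Iic (a := 2) (by norm_num) 0).congr_fun (fun x hx => ?_)
      measurableSet_Iic
    simp [abs_of_nonpos (Set.mem_Iic.1 hx)]
  · refine (integrableOn_exp_mul_Ioi (a := -2) (by norm_num) 0).congr_fun (fun x hx => ?_)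
      measurableSet_Ioi
    simp [abs_of_pos (Set.mem_Ioi.1 hx)]

/-- `η_θ` as an element of `L²(ℝ)`. -/
noncomputable def eta (θ : ℝ) : L2R := (memLp_etaFun θ).toLp (etaFun θ)

/-- The modified Bessel function of the second kind of order `0`, on the half-plane `Re z > 0`:
`K₀(z) = ∫₀^∞ e^{-z cosh t} dt`. -/
noncomputable def besselK0 (z : ℂ) : ℂ :=
  ∫ t in Set.Ioi (0 : ℝ), Complex.exp (-z * (Real.cosh t : ℝ))

/-- The irregular Kelvin function `ker = ker₀` on `(0, ∞)`, given by
`ker x + i kei x = K₀(x e^{iπ/4})`. It diverges at `0`. -/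
noncomputable def kelvinKer (x : ℝ) : ℝ :=
  (besselK0 (x * Complex.exp (Complex.I * (Real.pi / 4)))).re

/-- The irregular Kelvin function `kei = kei₀` on `[0, ∞)`, given on `(0, ∞)` by
`ker x + i kei x = K₀(x e^{iπ/4})` and at `0` by continuity, `kei 0 = -π/4`. -/
noncomputable def kelvinKei (x : ℝ) : ℝ :=
  if x = 0 then -(Real.pi / 4) else (besselK0 (x * Complex.exp (Complex.I * (Real.pi / 4)))).im

/-! Since `B F^* = F^* I`, each function is `-i S_λ^* F^* I η_θ`, so the matter is to compute `F^* I
η_θ`. The function `I η_θ` equals `k⁻¹ e^{-1/|k|}` times a phase `e^{±iθ/2}` on each half line. It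
lies in `L²` but decays only like `1/k`, so it is not integrable, and it is damped by `e^{-ε|k|}`.
The Fourier integral of the damped function splits at `0` into values at `ε ∓ ix` of the Laplace
transform of `k⁻¹ e^{-1/k}` (`integral_fourier_exp_mul_invEta`).

That transform is `2 K₀(2√s)` (`laplaceInvExp_eq`): a substitution proves it for `s > 0`, the
identity theorem for `Re s > 0`. The right side is analytic on the slit plane, so the limit `ε → 0`
exists at `±ix` for `x ≠ 0`, and `√(±ix)` produces `ker ± i kei`. The pointwise limit is the `L²`
limit (`coeFn_ae_eq_of_tendsto`). The phases for `θ = 0` and `θ = π` then select `kei` and `ker`. -/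

/-! ### The unitary Fourier transform on `L¹ ∩ L²`, and limits in `L²`. -/

section FourierLp

open FourierTransform SchwartzMap
open scoped ContDiff Topology

/-- The self-adjointness of the inverse Fourier integral. -/
theorem integral_fourierInv_mul_eq_of_integrable {f g : ℝ → ℂ} (hf : Integrable f)
    (hg : Integrable g) : ∫ x, 𝓕⁻ f x * g x = ∫ x, f x * 𝓕⁻ g x := by
  have h := VectorFourier.integral_fourierIntegral_smul_eq_flip (L := -innerₗ ℝ)
    Real.continuous_fourierChar (by
      simp only [LinearMap.neg_apply, innerₗ_apply_apply]; fun_prop) hf hg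
  have hflip : (-innerₗ ℝ).flip = -innerₗ ℝ := by
    ext; simp
  rw [hflip] at h
  exact h

/-- On `L¹ ∩ L²`, the inverse Fourier transform of `L²` is given by the Fourier integral. -/
theorem coeFn_fourierInv_toLp {f : ℝ → ℂ} (hf : Integrable f) (hf2 : MemLp f 2 volume) :
    ((Lp.fourierTransformₗᵢ ℝ ℂ).symm (hf2.toLp f) : ℝ → ℂ) =ᵐ[volume] 𝓕⁻ f := by
  have hcont : Continuous (𝓕⁻ f) :=
    VectorFourier.fourierIntegral_continuous Real.continuous_fourierChar
      (by simp only [LinearMap.neg_apply, innerₗ_apply_apply]; fun_prop) hf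
  -- Both sides are compared against smooth compactly supported functions. These are Schwartz, so
  -- the `L²` transform can be treated as a tempered distribution and moved onto the test function.
  refine ae_eq_of_integral_contDiff_smul_eq
    ((Lp.memLp _).locallyIntegrable (by norm_num)) hcont.locallyIntegrable ?_
  intro g g_smooth g_cpt
  have hg₁ : HasCompactSupport (Complex.ofRealCLM ∘ g) := g_cpt.comp_left rfl
  have hg₂ : ContDiff ℝ ∞ (Complex.ofRealCLM ∘ g) := by fun_prop
  set φ : 𝓢(ℝ, ℂ) := hg₁.toSchwartzMap hg₂ with hφ
  have hφg : ∀ x, φ x = (g x : ℂ) := fun x => rfl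
  have h1 := DFunLike.congr_fun
    (Lp.fourierInv_toTemperedDistribution_eq (E := ℝ) (F := ℂ) (hf2.toLp f)) φ
  rw [TemperedDistribution.fourierInv_apply, Lp.toTemperedDistribution_apply,
    Lp.toTemperedDistribution_apply] at h1
  have h2 := integral_fourierInv_mul_eq_of_integrable φ.integrable hf
  simp only [smul_eq_mul] at h1
  simp only [Complex.real_smul, ← hφg]
  refine h1.symm.trans (Eq.trans ?_ h2)
  refine integral_congr_ae ?_
  filter_upwards [hf2.coeFn_toLp] with x hx
  rw [hx, SchwartzMap.fourierInv_coe]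

theorem coeFn_dilationL2 {a : ℝ} (ha : 0 < a) (ψ : L2R) :
    dilationL2 a ha ψ =ᵐ[volume] fun x => (√a : ℂ) * ψ (a * x) :=
  coeFn_weightedComp (fun _ => √a) (fun x => a * x) (by fun_prop)
    (Filter.Eventually.of_forall fun _ => (Real.sqrt_pos.2 ha).ne')
    (measurePreserving_dilation ha) ψ

theorem coeFn_translationL2 (lam : ℝ) (ψ : L2R) :
    translationL2 lam ψ =ᵐ[volume] fun x => ψ (x - 1 / lam) := by
  have h := coeFn_weightedComp (fun _ => 1) (fun x => x - 1 / lam) (by fun_prop) (by simp)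
    (measurePreserving_translation _) ψ
  simp only [Complex.ofReal_one, one_mul] at h
  exact h

theorem coeFn_inversionL2 (ψ : L2R) :
    inversionL2 ψ =ᵐ[volume] fun x => ((x⁻¹ : ℝ) : ℂ) * ψ x⁻¹ :=
  coeFn_weightedComp (fun x => x⁻¹) (fun x => x⁻¹) (by fun_prop)
    (by filter_upwards [Measure.ae_ne volume (0 : ℝ)] with x hx using inv_ne_zero hx)
    measurePreserving_inversion ψ

/-- `dilationL2` is inverted through surjectivity, which gives no formula; the inverse is identified
by dilating the candidate back. -/
theorem dilationL2_symm_apply {a : ℝ} (ha : 0 < a) (ψ : L2R) :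
    (dilationL2 a ha).symm ψ = dilationL2 a⁻¹ (inv_pos.2 ha) ψ := by
  rw [LinearIsometryEquiv.symm_apply_eq]
  apply Lp.ext
  have h1 := coeFn_dilationL2 ha (dilationL2 a⁻¹ (inv_pos.2 ha) ψ)
  have h2 := coeFn_dilationL2 (inv_pos.2 ha) ψ
  have h3 := (quasiMeasurePreserving_of_weight (w := fun _ => √a) (by fun_prop)
    (Filter.Eventually.of_forall fun _ => (Real.sqrt_pos.2 ha).ne')
    (measurePreserving_dilation ha)).ae h2
  filter_upwards [h1, h3] with x e1 e3
  rw [e1, e3, ← mul_assoc, ← Complex.ofReal_mul, ← Real.sqrt_mul ha.le,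
    mul_inv_cancel₀ ha.ne', ← mul_assoc, inv_mul_cancel₀ ha.ne']
  simp

theorem translationL2_symm_apply (lam : ℝ) (ψ : L2R) :
    (translationL2 lam).symm ψ = translationL2 (-lam) ψ := by
  rw [LinearIsometryEquiv.symm_apply_eq]
  apply Lp.ext
  have h1 := coeFn_translationL2 lam (translationL2 (-lam) ψ)
  have h2 := coeFn_translationL2 (-lam) ψ
  have h3 := (measurePreserving_sub_right (volume : Measure ℝ)
    (1 / lam)).quasiMeasurePreserving.ae h2
  filter_upwards [h1, h3] with x e1 e3
  rw [e1, e3]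
  simp [div_neg]

theorem coeFn_translationL2_symm (lam : ℝ) (ψ : L2R) :
    (translationL2 lam).symm ψ =ᵐ[volume] fun x => ψ (x + 1 / lam) := by
  rw [translationL2_symm_apply]
  filter_upwards [coeFn_translationL2 (-lam) ψ] with x hx
  rw [hx]
  simp [div_neg]

/-- On `L¹ ∩ L²`, `(F^*ψ)(x) = (2π)^{-1/2} ∫ e^{ikx} ψ(k) dk`. -/
theorem coeFn_fourierL2_symm_toLp {f : ℝ → ℂ} (hf : Integrable f) (hf2 : MemLp f 2 volume) :
    (fourierL2.symm (hf2.toLp f) : ℝ → ℂ) =ᵐ[volume] fun x =>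
      ((√(2 * Real.pi))⁻¹ : ℝ) * ∫ k : ℝ, Complex.exp (Complex.I * x * k) * f k := by
  have hpi : (0 : ℝ) < (2 * Real.pi)⁻¹ := by positivity
  have ha0 : 0 < 2 * Real.pi := by positivity
  set a : ℝ := 2 * Real.pi with ha
  have hs : fourierL2.symm (hf2.toLp f) =
      (Lp.fourierTransformₗᵢ ℝ ℂ).symm (dilationL2 a⁻¹⁻¹ (inv_pos.2 hpi) (hf2.toLp f)) := by
    rw [← dilationL2_symm_apply hpi]; rfl
  have hd : dilationL2 a⁻¹⁻¹ (inv_pos.2 hpi) (hf2.toLp f) =ᵐ[volume]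
      fun x => (√a : ℂ) * f (a * x) := by
    have h1 := coeFn_dilationL2 (inv_pos.2 hpi) (hf2.toLp f)
    have h3 := (quasiMeasurePreserving_of_weight (w := fun _ => √(a⁻¹⁻¹)) (by fun_prop)
      (Filter.Eventually.of_forall fun _ => (Real.sqrt_pos.2 (inv_pos.2 hpi)).ne')
      (measurePreserving_dilation (inv_pos.2 hpi))).ae hf2.coeFn_toLp
    filter_upwards [h1, h3] with x e1 e3
    rw [e1, e3, inv_inv]
  have hint : Integrable fun x => (√a : ℂ) * f (a * x) :=
    (hf.comp_mul_left' ha0.ne').const_mul _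
  have hmem : MemLp (fun x => (√a : ℂ) * f (a * x)) 2 volume :=
    (memLp_congr_ae hd).1 (Lp.memLp _)
  have heq : dilationL2 a⁻¹⁻¹ (inv_pos.2 hpi) (hf2.toLp f) = hmem.toLp _ :=
    Lp.ext (hd.trans hmem.coeFn_toLp.symm)
  rw [hs, heq]
  filter_upwards [coeFn_fourierInv_toLp hint hmem] with x hx
  rw [hx, Real.fourierInv_eq']
  have hsub := Measure.integral_comp_mul_left
    (fun k : ℝ => Complex.exp (Complex.I * x * k) * f k) a
  rw [abs_of_pos (inv_pos.2 ha0)] at hsub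
  have : ∫ k : ℝ, Complex.exp (Complex.I * x * k) * f k =
      a • ∫ k : ℝ, Complex.exp (Complex.I * x * ((a * k : ℝ) : ℂ)) * f (a * k) := by
    rw [hsub, smul_smul, mul_inv_cancel₀ ha0.ne', one_smul]
  rw [this, Complex.real_smul, ← mul_assoc, ← Complex.ofReal_mul, ← integral_const_mul]
  -- The Jacobian `2π` of the substitution times the normalization `(2π)^{-1/2}` is the weight of
  -- the dilation.
  have hc : (√a)⁻¹ * a = √a := by
    rw [inv_mul_eq_div, Real.div_sqrt]
  rw [hc]
  refine integral_congr_ae (Filter.Eventually.of_forall fun k => ?_)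
  simp only [smul_eq_mul, RCLike.inner_apply, conj_trivial]
  rw [mul_left_comm]
  congr 3
  push_cast [ha]
  ring

/-- An `L²` limit of functions converging almost everywhere is the pointwise limit. -/
theorem coeFn_ae_eq_of_tendsto {u : ℕ → L2R} {v : L2R} (hu : Filter.Tendsto u Filter.atTop (𝓝 v))
    {h : ℝ → ℂ} (hlim : ∀ᵐ x, Filter.Tendsto (fun n => u n x) Filter.atTop (𝓝 (h x))) :
    v =ᵐ[volume] h := by
  -- Convergence in measure yields a subsequence converging almost everywhere to `v`, which must
  -- share the limit `h`.
  have hm : TendstoInMeasure volume (fun n => (u n : ℝ → ℂ)) Filter.atTop v :=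
    tendstoInMeasure_of_tendsto_eLpNorm (p := 2) (by norm_num)
      (fun n => Lp.aestronglyMeasurable _) (Lp.aestronglyMeasurable _)
      ((Lp.tendsto_Lp_iff_tendsto_eLpNorm' _ _).1 hu)
  obtain ⟨ns, hns, hae⟩ := hm.exists_seq_tendsto_ae
  filter_upwards [hae, hlim] with x h1 h2
  exact tendsto_nhds_unique h1 (h2.comp hns.tendsto_atTop)

/-- Dominated convergence in `L²` for multiplication by bounded functions. -/
theorem tendsto_toLp_mul_of_bounded {g : ℝ → ℂ} (hg : MemLp g 2 volume) {c : ℕ → ℝ → ℂ}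
    (hcm : ∀ n, MemLp (fun x => c n x * g x) 2 volume) (hcb : ∀ n x, ‖c n x‖ ≤ 1)
    (hc : ∀ x, Filter.Tendsto (fun n => c n x) Filter.atTop (𝓝 1)) :
    Filter.Tendsto (fun n => (hcm n).toLp (fun x => c n x * g x)) Filter.atTop
      (𝓝 (hg.toLp g)) := by
  rw [Lp.tendsto_Lp_iff_tendsto_eLpNorm'']
  have hlin : Filter.Tendsto (fun n => ∫⁻ x, ‖c n x * g x - g x‖ₑ ^ (2 : ℝ)) Filter.atTop
      (𝓝 (∫⁻ _ : ℝ, 0)) := by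
    refine tendsto_lintegral_of_dominated_convergence' (fun x => ‖2 * g x‖ₑ ^ (2 : ℝ))
      (fun n => ?_) (fun n => ?_) ?_ ?_
    · exact (((hcm n).sub hg).aestronglyMeasurable.enorm).pow_const _
    · refine Filter.Eventually.of_forall fun x => ?_
      refine ENNReal.rpow_le_rpow ?_ (by norm_num)
      rw [enorm_le_iff_norm_le]
      calc ‖c n x * g x - g x‖ ≤ ‖c n x * g x‖ + ‖g x‖ := norm_sub_le _ _
        _ ≤ 1 * ‖g x‖ + ‖g x‖ := by
          rw [norm_mul]; gcongr; exact hcb n x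
        _ = ‖2 * g x‖ := by rw [norm_mul]; norm_num; ring
    · have := (hg.const_mul (2 : ℂ)).eLpNorm_lt_top
      rw [eLpNorm_lt_top_iff_lintegral_rpow_enorm_lt_top (by norm_num) (by norm_num)] at this
      simpa using this.ne
    · refine Filter.Eventually.of_forall fun x => ?_
      have h1 : Filter.Tendsto (fun n => c n x * g x - g x) Filter.atTop (𝓝 (1 * g x - g x)) :=
        ((hc x).mul_const _).sub_const _
      have h2 := (ENNReal.continuous_rpow_const (y := 2)).tendsto _ |>.comp
        (continuous_enorm.tendsto _ |>.comp h1)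
      simpa [Function.comp_def] using h2
  rw [lintegral_zero] at hlin
  have h3 := (ENNReal.continuous_rpow_const (y := 1 / 2)).tendsto _ |>.comp hlin
  rw [ENNReal.zero_rpow_of_pos (by norm_num)] at h3
  refine h3.congr fun n => ?_
  rw [eLpNorm_eq_lintegral_rpow_enorm_toReal (by norm_num) (by norm_num)]
  simp

end FourierLp

/-! ### The Laplace transform of `k⁻¹ e^{-1/k}` and the function `K₀`. -/

section BesselIntegral

open ProbabilityTheory Complex
open scoped Topology

theorem one_add_le_two_mul_cosh (t : ℝ) : 1 + t ≤ 2 * Real.cosh t := by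
  have h1 := Real.add_one_le_exp t
  have h2 := Real.exp_pos (-t)
  rw [Real.cosh_eq]
  linarith

theorem integrableOn_exp_neg_mul_cosh {c : ℝ} (hc : 0 < c) :
    IntegrableOn (fun t => Real.exp (-(c * Real.cosh t))) (Set.Ioi 0) := by
  refine Integrable.mono' (integrableOn_exp_mul_Ioi (a := -(c / 2)) (by linarith) 0)
    (by fun_prop) (Filter.Eventually.of_forall fun t => ?_)
  rw [Real.norm_of_nonneg (Real.exp_pos _).le, Real.exp_le_exp]
  nlinarith [one_add_le_two_mul_cosh t]

/-- `K₀` is the complex moment generating function of `-cosh t` under Lebesgue measure on the half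
line, hence holomorphic over the interior of its integrability set. -/
theorem differentiableAt_besselK0 {z : ℂ} (hz : 0 < z.re) : DifferentiableAt ℂ besselK0 z := by
  have hset : Set.Ioi (0 : ℝ) ⊆
      integrableExpSet (fun t => -Real.cosh t) (volume.restrict (Set.Ioi 0)) := fun c hc => by
    simpa [integrableExpSet, IntegrableOn] using integrableOn_exp_neg_mul_cosh hc
  have h := hasDerivAt_complexMGF (interior_maximal hset isOpen_Ioi hz)
  have heq : complexMGF (fun t => -Real.cosh t) (volume.restrict (Set.Ioi 0)) = besselK0 := by
    ext z
    simp only [complexMGF, besselK0, ofReal_neg, mul_neg, neg_mul]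
  rw [heq] at h
  exact h.differentiableAt

open ComplexConjugate in
theorem besselK0_conj (z : ℂ) : besselK0 (conj z) = conj (besselK0 z) := by
  unfold besselK0
  rw [← integral_conj]
  refine integral_congr_ae (Filter.Eventually.of_forall fun t => ?_)
  simp only [← exp_conj, map_mul, map_neg, conj_ofReal]

/-- The weight `k⁻¹ e^{-1/k}`, the restriction of `I η₀` to the positive half line. -/
noncomputable def invExpWeight (k : ℝ) : ℝ := k⁻¹ * Real.exp (-k⁻¹)

theorem measurable_invExpWeight : Measurable invExpWeight := by
  unfold invExpWeight; fun_prop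

theorem invExpWeight_nonneg {k : ℝ} (hk : 0 ≤ k) : 0 ≤ invExpWeight k := by
  unfold invExpWeight; positivity

/-- This is `y ≤ e^y` for `y = k⁻¹`, valid for every real `k` with the convention `0⁻¹ = 0`. -/
theorem invExpWeight_le_one (k : ℝ) : invExpWeight k ≤ 1 := by
  have h := Real.add_one_le_exp k⁻¹
  rw [invExpWeight, Real.exp_neg, mul_inv_le_iff₀ (Real.exp_pos _)]
  linarith

/-- The Laplace transform of `k⁻¹ e^{-1/k}` on the positive half line. -/
noncomputable def laplaceInvExp (s : ℂ) : ℂ :=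
  ∫ k in Set.Ioi (0 : ℝ), exp (-s * k) * invExpWeight k

theorem integrableOn_exp_mul_invExpWeight {s : ℂ} (hs : 0 < s.re) :
    IntegrableOn (fun k : ℝ => exp (-s * k) * invExpWeight k) (Set.Ioi 0) := by
  have hm := measurable_invExpWeight
  refine Integrable.mono' (integrableOn_exp_mul_Ioi (a := -s.re) (by linarith) 0)
    (Measurable.aestronglyMeasurable (by fun_prop))
    ((ae_restrict_mem measurableSet_Ioi).mono fun k hk => ?_)
  rw [norm_mul, norm_exp, norm_real, Real.norm_of_nonneg (invExpWeight_nonneg (le_of_lt hk))]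
  simpa using mul_le_mul_of_nonneg_left (invExpWeight_le_one k) (Real.exp_pos (-(s.re * k))).le

/-- Again a complex moment generating function, of `-k` under the measure with density
`invExpWeight`. -/
theorem differentiableAt_laplaceInvExp {s : ℂ} (hs : 0 < s.re) :
    DifferentiableAt ℂ laplaceInvExp s := by
  have hm := measurable_invExpWeight
  set ν : Measure ℝ := (volume.restrict (Set.Ioi 0)).withDensity
    fun k => ENNReal.ofReal (invExpWeight k) with hν
  have hmass : Measurable fun k => ENNReal.ofReal (invExpWeight k) := hm.ennreal_ofReal
  have hlt : ∀ᵐ k ∂(volume.restrict (Set.Ioi (0 : ℝ))), ENNReal.ofReal (invExpWeight k) < ⊤ :=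
    Filter.Eventually.of_forall fun _ => ENNReal.ofReal_lt_top
  have hset : Set.Ioi (0 : ℝ) ⊆ integrableExpSet (fun k => -k) ν := fun c hc => by
    change Integrable _ _
    rw [hν, integrable_withDensity_iff_integrable_smul' hmass hlt]
    have h := (integrableOn_exp_mul_invExpWeight (s := c) (by simpa using hc)).norm
    refine h.congr ((ae_restrict_mem measurableSet_Ioi).mono fun k hk => ?_)
    have h0 := invExpWeight_nonneg (le_of_lt hk)
    simp only [norm_mul, norm_exp, norm_real, Real.norm_of_nonneg h0, ENNReal.toReal_ofReal h0,
      smul_eq_mul]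
    simp [mul_comm]
  have h := hasDerivAt_complexMGF (interior_maximal hset isOpen_Ioi hs)
  have heq : complexMGF (fun k => -k) ν = laplaceInvExp := by
    ext z
    rw [complexMGF, laplaceInvExp, hν, integral_withDensity_eq_integral_toReal_smul hmass hlt]
    refine integral_congr_ae ((ae_restrict_mem measurableSet_Ioi).mono fun k hk => ?_)
    simp only [ENNReal.toReal_ofReal (invExpWeight_nonneg (le_of_lt hk)), real_smul, ofReal_neg,
      mul_neg, neg_mul]
    rw [mul_comm]
  rw [heq] at h
  exact h.differentiableAt

/-- The substitution `k = e^u / r` turns `r² k + 1/k` into `2r cosh u` and `dk/k` into `du`; the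
factor `2` comes from evenness in `u`. -/
theorem laplaceInvExp_sq {r : ℝ} (hr : 0 < r) :
    laplaceInvExp ((r ^ 2 : ℝ) : ℂ) = 2 * besselK0 ((2 * r : ℝ) : ℂ) := by
  have himg : (fun u : ℝ => Real.exp u / r) '' Set.univ = Set.Ioi 0 := by
    ext k
    simp only [Set.image_univ, Set.mem_range, Set.mem_Ioi]
    constructor
    · rintro ⟨u, rfl⟩; positivity
    · intro hk
      exact ⟨Real.log (r * k), by rw [Real.exp_log (by positivity)]; field_simp⟩
  have hsub := integral_image_eq_integral_abs_deriv_smul (f := fun u : ℝ => Real.exp u / r)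
    (f' := fun u => Real.exp u / r) MeasurableSet.univ
    (fun u _ => ((Real.hasDerivAt_exp u).div_const r).hasDerivWithinAt)
    (fun u _ v _ huv => by
      have : Real.exp u = Real.exp v := by
        have huv' : Real.exp u / r = Real.exp v / r := huv
        field_simp at huv'
        exact huv'
      exact Real.exp_injective this)
    (fun k : ℝ => exp (-((r ^ 2 : ℝ) : ℂ) * k) * invExpWeight k)
  rw [himg, Measure.restrict_univ] at hsub
  have hK : besselK0 ((2 * r : ℝ) : ℂ) =
      ((∫ t in Set.Ioi (0 : ℝ), Real.exp (-(2 * r * Real.cosh t)) : ℝ) : ℂ) := by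
    rw [besselK0, ← integral_complex_ofReal]
    simp
  rw [laplaceInvExp, hsub, hK, ← ofReal_ofNat, ← ofReal_mul,
    ← integral_comp_abs (f := fun t : ℝ => Real.exp (-(2 * r * Real.cosh t))), ← integral_complex_ofReal]
  refine integral_congr_ae (Filter.Eventually.of_forall fun u => ?_)
  have hpos : 0 < Real.exp u / r := by positivity
  simp only [abs_of_pos hpos, Real.cosh_abs, invExpWeight, real_smul]
  rw [← ofReal_neg, ← ofReal_mul, ← ofReal_exp, ← ofReal_mul, ← ofReal_mul,
    ofReal_inj, mul_left_comm, mul_inv_cancel_left₀ hpos.ne', ← Real.exp_add]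
  congr 1
  rw [Real.cosh_eq, Real.exp_neg]
  field_simp
  ring

theorem cpow_half_re_pos {s : ℂ} (hs : s ∈ slitPlane) : 0 < (s ^ (2⁻¹ : ℂ)).re := by
  rw [cpow_inv_two_re, Real.sqrt_pos]
  have h : -‖s‖ < s.re := by
    rcases hs with h | h
    · have := norm_nonneg s; linarith
    · have := abs_re_lt_norm.2 h
      exact (abs_lt.1 this).1
  linarith

/-- The principal root maps the slit plane into the right half plane. The domain thus contains the
punctured imaginary axis, where the Laplace formula itself is not available. -/
theorem differentiableAt_besselK0_sqrt {s : ℂ} (hs : s ∈ slitPlane) :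
    DifferentiableAt ℂ (fun s : ℂ => 2 * besselK0 (2 * s ^ (2⁻¹ : ℂ))) s := by
  have h := cpow_half_re_pos hs
  have h1 : DifferentiableAt ℂ (fun s : ℂ => 2 * s ^ (2⁻¹ : ℂ)) s :=
    (differentiableAt_id.cpow_const hs).const_mul 2
  have h2 : DifferentiableAt ℂ besselK0 (2 * s ^ (2⁻¹ : ℂ)) :=
    differentiableAt_besselK0 (by simpa using h)
  exact (h2.comp s h1).const_mul 2

/-- `∫₀^∞ e^{-sk-1/k} dk/k = 2 K₀(2√s)` for `Re s > 0`. -/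
theorem laplaceInvExp_eq {s : ℂ} (hs : 0 < s.re) :
    laplaceInvExp s = 2 * besselK0 (2 * s ^ (2⁻¹ : ℂ)) := by
  have hopen : IsOpen {z : ℂ | 0 < z.re} := isOpen_lt continuous_const continuous_re
  have h1 : AnalyticOnNhd ℂ laplaceInvExp {z : ℂ | 0 < z.re} :=
    DifferentiableOn.analyticOnNhd
      (fun z hz => (differentiableAt_laplaceInvExp hz).differentiableWithinAt) hopen
  have h2 : AnalyticOnNhd ℂ (fun s : ℂ => 2 * besselK0 (2 * s ^ (2⁻¹ : ℂ))) {z : ℂ | 0 < z.re} :=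
    DifferentiableOn.analyticOnNhd
      (fun z hz => (differentiableAt_besselK0_sqrt (Or.inl hz)).differentiableWithinAt) hopen
  -- Identity theorem on the half plane: the two sides agree at real points accumulating at `1`.
  refine AnalyticOnNhd.eqOn_of_preconnected_of_frequently_eq h1 h2
    (convex_halfSpace_re_gt 0).isPreconnected (z₀ := 1) (by simp) ?_ hs
  have hreal : ∀ r : ℝ, 0 < r →
      laplaceInvExp r = 2 * besselK0 (2 * (r : ℂ) ^ (2⁻¹ : ℂ)) := by
    intro r hr
    have hsq := laplaceInvExp_sq (Real.sqrt_pos.2 hr)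
    rw [Real.sq_sqrt hr.le] at hsq
    rw [hsq, Real.sqrt_eq_rpow, ofReal_mul, ofReal_cpow hr.le]
    norm_num
  have hmap : Filter.Tendsto (fun r : ℝ => (r : ℂ)) (𝓝[≠] 1) (𝓝[≠] (1 : ℂ)) := by
    refine tendsto_nhdsWithin_of_tendsto_nhds_of_eventually_within _ ?_ ?_
    · exact (continuous_ofReal.tendsto' 1 1 (by simp)).mono_left nhdsWithin_le_nhds
    · filter_upwards [self_mem_nhdsWithin] with r hr
      simpa using hr
  refine hmap.frequently (Filter.Eventually.frequently ?_)
  filter_upwards [nhdsWithin_le_nhds (lt_mem_nhds (zero_lt_one' ℝ))] with r hr using hreal r hr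

theorem I_mul_cpow_half {x : ℝ} (hx : 0 < x) :
    (I * x) ^ (2⁻¹ : ℂ) = √x * exp (I * (Real.pi / 4)) := by
  have hx' : (x : ℂ) ≠ 0 := by exact_mod_cast hx.ne'
  rw [mul_comm I, cpow_def_of_ne_zero (mul_ne_zero hx' I_ne_zero),
    log_ofReal_mul hx I_ne_zero, log_I, add_mul, exp_add, Real.sqrt_eq_rpow, ofReal_cpow hx.le,
    cpow_def_of_ne_zero hx', ofReal_log hx.le]
  congr 2
  · norm_num
  · ring

theorem neg_I_mul_cpow_half {x : ℝ} (hx : 0 < x) :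
    (-I * x) ^ (2⁻¹ : ℂ) = √x * exp (-(I * (Real.pi / 4))) := by
  have hx' : (x : ℂ) ≠ 0 := by exact_mod_cast hx.ne'
  rw [mul_comm (-I), cpow_def_of_ne_zero (mul_ne_zero hx' (neg_ne_zero.2 I_ne_zero)),
    log_ofReal_mul hx (neg_ne_zero.2 I_ne_zero), log_neg_I, add_mul, exp_add, Real.sqrt_eq_rpow,
    ofReal_cpow hx.le, cpow_def_of_ne_zero hx', ofReal_log hx.le]
  congr 2
  · norm_num
  · ring

theorem besselK0_I_mul_cpow_half {x : ℝ} (hx : 0 < x) :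
    besselK0 (2 * (I * x) ^ (2⁻¹ : ℂ)) = kelvinKer (2 * √x) + I * kelvinKei (2 * √x) := by
  have h : 2 * √x ≠ 0 := by positivity
  rw [kelvinKer, kelvinKei, if_neg h, I_mul_cpow_half hx, mul_comm I (ofReal _), re_add_im,
    ofReal_mul, ofReal_ofNat, mul_assoc]

/-- The roots of `±ix` are conjugate and `K₀` commutes with conjugation. -/
theorem besselK0_neg_I_mul_cpow_half {x : ℝ} (hx : 0 < x) :
    besselK0 (2 * (-I * x) ^ (2⁻¹ : ℂ)) = kelvinKer (2 * √x) - I * kelvinKei (2 * √x) := by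
  have h := congrArg (starRingEnd ℂ) (besselK0_I_mul_cpow_half hx)
  rw [← besselK0_conj, I_mul_cpow_half hx] at h
  rw [neg_I_mul_cpow_half hx]
  simpa [← exp_conj, sub_eq_add_neg, conj_ofNat] using h

/-- The boundary values of the Laplace transform of `k⁻¹ e^{-1/k}` on the imaginary axis. -/
theorem tendsto_laplaceInvExp {s : ℂ} (hre : s.re = 0) (him : s.im ≠ 0) {ε : ℕ → ℝ}
    (hε : ∀ n, 0 < ε n) (hε0 : Filter.Tendsto ε Filter.atTop (𝓝 0)) :
    Filter.Tendsto (fun n => laplaceInvExp (s + ε n)) Filter.atTop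
      (𝓝 (2 * besselK0 (2 * s ^ (2⁻¹ : ℂ)))) := by
  have hs : s ∈ slitPlane := Or.inr him
  have h1 : Filter.Tendsto (fun n => s + ε n) Filter.atTop (𝓝 s) := by
    simpa using ((continuous_ofReal.tendsto 0).comp hε0).const_add s
  refine ((differentiableAt_besselK0_sqrt hs).continuousAt.tendsto.comp h1).congr fun n => ?_
  rw [laplaceInvExp_eq (by simpa [hre] using hε n)]
  rfl

end BesselIntegral

/-! ### The inverse Fourier transform of `I η_θ`, and the two special phases. -/

section InvertedEta

open Complex
open scoped Topology

/-- The function `(I η_θ)(k) = k⁻¹ η_θ(k⁻¹)`. -/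
noncomputable def invEta (θ k : ℝ) : ℂ := (k⁻¹ : ℝ) * etaFun θ k⁻¹

theorem measurable_invEta (θ : ℝ) : Measurable (invEta θ) := by
  have := measurable_real_sign
  unfold invEta etaFun
  fun_prop

theorem norm_invEta_le_one (θ k : ℝ) : ‖invEta θ k‖ ≤ 1 := by
  have h := invExpWeight_le_one |k|
  rw [invEta, norm_mul, norm_etaFun, norm_real, Real.norm_eq_abs, abs_inv]
  exact h

theorem coeFn_inversionL2_eta (θ : ℝ) : inversionL2 (eta θ) =ᵐ[volume] invEta θ := by
  have hq := quasiMeasurePreserving_of_weight (w := fun x => x⁻¹) (by fun_prop)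
    (by filter_upwards [Measure.ae_ne volume (0 : ℝ)] with x hx using inv_ne_zero hx)
    measurePreserving_inversion
  filter_upwards [coeFn_inversionL2 (eta θ), hq.ae (memLp_etaFun θ).coeFn_toLp] with x h1 h2
  rw [h1, _root_.eta, h2, invEta]

theorem memLp_invEta (θ : ℝ) : MemLp (invEta θ) 2 volume :=
  (memLp_congr_ae (coeFn_inversionL2_eta θ)).1 (Lp.memLp _)

theorem inversionL2_eta (θ : ℝ) : inversionL2 (eta θ) = (memLp_invEta θ).toLp (invEta θ) :=
  Lp.ext ((coeFn_inversionL2_eta θ).trans (memLp_invEta θ).coeFn_toLp.symm)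

theorem invEta_of_pos (θ : ℝ) {k : ℝ} (hk : 0 < k) :
    invEta θ k = exp (I * (θ / 2 : ℝ)) * invExpWeight k := by
  have hk' := inv_pos.2 hk
  simp only [invEta, etaFun, invExpWeight, abs_of_pos hk', Real.sign_of_pos hk']
  push_cast
  rw [mul_one]
  ring

theorem invEta_neg_of_pos (θ : ℝ) {k : ℝ} (hk : 0 < k) :
    invEta θ (-k) = -(exp (-(I * (θ / 2 : ℝ))) * invExpWeight k) := by
  have hk' := inv_pos.2 hk
  simp only [invEta, etaFun, invExpWeight, inv_neg, abs_neg, abs_of_pos hk',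
    Real.sign_of_neg (neg_lt_zero.2 hk')]
  push_cast
  rw [mul_neg, mul_one, neg_mul, neg_mul]
  ring

theorem norm_exp_neg_mul_abs_le_one {ε : ℝ} (hε : 0 < ε) (k : ℝ) :
    ‖exp (-(ε * |k| : ℝ))‖ ≤ 1 := by
  rw [norm_exp]
  have : 0 ≤ ε * |k| := by positivity
  simpa using this

theorem integrable_exp_neg_mul_abs {ε : ℝ} (hε : 0 < ε) :
    Integrable fun k : ℝ => Real.exp (-(ε * |k|)) := by
  rw [← integrableOn_univ, ← Set.Iic_union_Ioi (a := (0 : ℝ))]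
  refine IntegrableOn.union ?_ ?_
  · refine (integrableOn_exp_mul_Iic (a := ε) hε 0).congr_fun (fun x hx => ?_) measurableSet_Iic
    simp [abs_of_nonpos (Set.mem_Iic.1 hx)]
  · refine (integrableOn_exp_mul_Ioi (a := -ε) (by linarith) 0).congr_fun (fun x hx => ?_)
      measurableSet_Ioi
    simp [abs_of_pos (Set.mem_Ioi.1 hx)]

theorem integrable_exp_mul_invEta (θ : ℝ) {ε : ℝ} (hε : 0 < ε) :
    Integrable fun k : ℝ => exp (-(ε * |k| : ℝ)) * invEta θ k := by
  have hm := measurable_invEta θ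
  refine (integrable_exp_neg_mul_abs hε).mono' (Measurable.aestronglyMeasurable (by fun_prop))
    (Filter.Eventually.of_forall fun k => ?_)
  rw [norm_mul, norm_exp]
  simpa using mul_le_mul_of_nonneg_left (norm_invEta_le_one θ k) (Real.exp_pos (-(ε * |k|))).le

theorem memLp_exp_mul_invEta (θ : ℝ) {ε : ℝ} (hε : 0 < ε) :
    MemLp (fun k : ℝ => exp (-(ε * |k| : ℝ)) * invEta θ k) 2 volume := by
  have hm := measurable_invEta θ
  refine (memLp_invEta θ).mono (Measurable.aestronglyMeasurable (by fun_prop))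
    (Filter.Eventually.of_forall fun k => ?_)
  rw [norm_mul]
  exact mul_le_of_le_one_left (norm_nonneg _) (norm_exp_neg_mul_abs_le_one hε k)

/-- The integral is split at `0` and the negative half reflected. The minus sign is the oddness of
`k⁻¹`, and `sgn` conjugates the phase. -/
theorem integral_fourier_exp_mul_invEta (θ x : ℝ) {ε : ℝ} (hε : 0 < ε) :
    ∫ k : ℝ, exp (I * x * k) * (exp (-(ε * |k| : ℝ)) * invEta θ k) =
      exp (I * (θ / 2 : ℝ)) * laplaceInvExp (-I * x + ε) -
        exp (-(I * (θ / 2 : ℝ))) * laplaceInvExp (I * x + ε) := by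
  set f : ℝ → ℂ := fun k => exp (I * x * k) * (exp (-(ε * |k| : ℝ)) * invEta θ k) with hf
  have hint : Integrable f := by
    refine (integrable_exp_mul_invEta θ hε).mono (by
      have hm := measurable_invEta θ
      exact Measurable.aestronglyMeasurable (by fun_prop))
      (Filter.Eventually.of_forall fun k => ?_)
    rw [hf]
    simp [norm_exp]
  have hpos : ∫ k in Set.Ioi (0 : ℝ), f k =
      exp (I * (θ / 2 : ℝ)) * laplaceInvExp (-I * x + ε) := by
    rw [laplaceInvExp, ← integral_const_mul]
    refine setIntegral_congr_fun measurableSet_Ioi fun k hk => ?_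
    simp only [hf]
    rw [invEta_of_pos θ hk, abs_of_pos hk, mul_left_comm (exp (-(ε * k : ℝ))), mul_left_comm,
      ← mul_assoc (exp (I * x * k)), ← exp_add]
    congr 3
    push_cast
    ring
  have hneg : ∫ k in Set.Iic (0 : ℝ), f k =
      -(exp (-(I * (θ / 2 : ℝ))) * laplaceInvExp (I * x + ε)) := by
    have hrefl := integral_comp_neg_Ioi (0 : ℝ) f
    rw [neg_zero] at hrefl
    rw [← hrefl, laplaceInvExp, ← integral_const_mul, ← integral_neg]
    refine setIntegral_congr_fun measurableSet_Ioi fun k hk => ?_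
    simp only [hf]
    rw [invEta_neg_of_pos θ hk, abs_neg, abs_of_pos hk, mul_neg, mul_neg,
      mul_left_comm (exp (-(ε * k : ℝ))), mul_left_comm,
      ← mul_assoc (exp (I * x * (-k : ℝ))), ← exp_add]
    congr 4
    push_cast
    ring
  rw [← intervalIntegral.integral_Iic_add_Ioi hint.integrableOn hint.integrableOn, hpos, hneg]
  ring

/-- `F^* I η_θ` in terms of `K₀`. -/
theorem coeFn_fourierL2_symm_inversionL2_eta (θ : ℝ) :
    (fourierL2.symm (inversionL2 (eta θ)) : ℝ → ℂ) =ᵐ[volume] fun x =>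
      ((√(2 * Real.pi))⁻¹ : ℝ) *
        (exp (I * (θ / 2 : ℝ)) * (2 * besselK0 (2 * (-I * x) ^ (2⁻¹ : ℂ))) -
          exp (-(I * (θ / 2 : ℝ))) * (2 * besselK0 (2 * (I * x) ^ (2⁻¹ : ℂ)))) := by
  set ε : ℕ → ℝ := fun n => 1 / ((n : ℝ) + 1) with hε
  have hεpos : ∀ n, 0 < ε n := fun n => Nat.one_div_pos_of_nat
  have hε0 : Filter.Tendsto ε Filter.atTop (𝓝 0) := tendsto_one_div_add_atTop_nhds_zero_nat
  have hL2 := tendsto_toLp_mul_of_bounded (memLp_invEta θ)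
    (c := fun n k => exp (-(ε n * |k| : ℝ))) (fun n => memLp_exp_mul_invEta θ (hεpos n))
    (fun n k => norm_exp_neg_mul_abs_le_one (hεpos n) k) (fun k => by
      have h1 : Filter.Tendsto (fun n => ε n * |k|) Filter.atTop (𝓝 0) := by
        simpa using hε0.mul_const |k|
      have h2 : Continuous fun t : ℝ => exp (-(t : ℂ)) := by fun_prop
      exact (h2.tendsto' 0 1 (by simp)).comp h1)
  have hF := (fourierL2.symm.continuous.tendsto _).comp hL2
  rw [inversionL2_eta]
  refine coeFn_ae_eq_of_tendsto hF ?_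
  -- The dampings form a sequence, so a single null set serves for all of them.
  have hae := ae_all_iff.2 fun n => coeFn_fourierL2_symm_toLp
    (integrable_exp_mul_invEta θ (hεpos n)) (memLp_exp_mul_invEta θ (hεpos n))
  filter_upwards [hae, Measure.ae_ne volume (0 : ℝ)] with x hx hx0
  have h1 := tendsto_laplaceInvExp (s := -I * x) (by simp) (by simpa using hx0) hεpos hε0
  have h2 := tendsto_laplaceInvExp (s := I * x) (by simp) (by simpa using hx0) hεpos hε0
  refine (((h1.const_mul _).sub (h2.const_mul _)).const_mul _).congr fun n => ?_
  rw [← integral_fourier_exp_mul_invEta θ x (hεpos n)]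
  exact (hx n).symm

theorem two_mul_two_mul_inv_sqrt_two_pi : 2 * 2 * (√(2 * Real.pi))⁻¹ = √(8 / Real.pi) := by
  have hpi := Real.pi_pos
  rw [eq_comm, Real.sqrt_eq_iff_eq_sq (by positivity) (by positivity), mul_pow, inv_pow,
    Real.sq_sqrt (by positivity)]
  field_simp
  norm_num

/-- Both phases are `1`, so a value of `K₀` is subtracted from its conjugate: `ker` cancels, and
`kei` remains with a sign odd in `x`. -/
theorem coeFn_fourierL2_symm_inversionL2_eta_zero :
    (fourierL2.symm (inversionL2 (eta 0)) : ℝ → ℂ) =ᵐ[volume] fun x =>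
      I * ((-√(8 / Real.pi) * Real.sign x * kelvinKei (2 * √|x|) : ℝ) : ℂ) := by
  filter_upwards [coeFn_fourierL2_symm_inversionL2_eta 0, Measure.ae_ne volume (0 : ℝ)]
    with x hx hx0
  rw [hx, ← two_mul_two_mul_inv_sqrt_two_pi]
  rcases lt_or_gt_of_ne hx0 with h | h
  -- For `x < 0` the two boundary points exchange roles, as `ix = -i(-x)`.
  · have h' := neg_pos.2 h
    have e1 := besselK0_I_mul_cpow_half h'
    have e2 := besselK0_neg_I_mul_cpow_half h'
    rw [ofReal_neg, mul_neg, ← neg_mul] at e1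
    rw [ofReal_neg, neg_mul_neg] at e2
    rw [e1, e2, abs_of_neg h, Real.sign_of_neg h]
    push_cast
    simp
    ring
  · rw [besselK0_I_mul_cpow_half h, besselK0_neg_I_mul_cpow_half h, abs_of_pos h,
      Real.sign_of_pos h]
    push_cast
    simp
    ring

/-- The phases `i` and `-i` turn the difference into `i` times the sum of conjugate values: `kei`
cancels, and the result is even in `x`. -/
theorem coeFn_fourierL2_symm_inversionL2_eta_pi :
    (fourierL2.symm (inversionL2 (eta Real.pi)) : ℝ → ℂ) =ᵐ[volume] fun x =>
      I * ((√(8 / Real.pi) * kelvinKer (2 * √|x|) : ℝ) : ℂ) := by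
  have hI : exp (I * (Real.pi / 2 : ℝ)) = I := by
    rw [mul_comm]; push_cast; exact exp_pi_div_two_mul_I
  filter_upwards [coeFn_fourierL2_symm_inversionL2_eta Real.pi, Measure.ae_ne volume (0 : ℝ)]
    with x hx hx0
  rw [hx, ← two_mul_two_mul_inv_sqrt_two_pi, exp_neg, hI, inv_I]
  rcases lt_or_gt_of_ne hx0 with h | h
  · have h' := neg_pos.2 h
    have e1 := besselK0_I_mul_cpow_half h'
    have e2 := besselK0_neg_I_mul_cpow_half h'
    rw [ofReal_neg, mul_neg, ← neg_mul] at e1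
    rw [ofReal_neg, neg_mul_neg] at e2
    rw [e1, e2, abs_of_neg h]
    push_cast
    ring
  · rw [besselK0_I_mul_cpow_half h, besselK0_neg_I_mul_cpow_half h, abs_of_pos h]
    push_cast
    ring

theorem coeFn_neg_I_smul_opBlam (lam θ : ℝ) {h : ℝ → ℂ}
    (hh : (fourierL2.symm (inversionL2 (eta θ)) : ℝ → ℂ) =ᵐ[volume] fun x => I * h x) :
    ((-I • opBlam lam (fourierL2.symm (eta θ)) : L2R) : ℝ → ℂ) =ᵐ[volume]
      fun x => h (x + 1 / lam) := by
  -- The inner `F F^*` cancels, leaving `S_λ^* F^* I`.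
  have hB : opBlam lam (fourierL2.symm (eta θ)) =
      (translationL2 lam).symm (fourierL2.symm (inversionL2 (eta θ))) := by
    simp [opBlam, opB]
  have hshift := (measurePreserving_add_right (volume : Measure ℝ)
    (1 / lam)).quasiMeasurePreserving.ae hh
  rw [hB]
  filter_upwards [Lp.coeFn_smul (-I) ((translationL2 lam).symm
    (fourierL2.symm (inversionL2 (eta θ)))), coeFn_translationL2_symm lam
    (fourierL2.symm (inversionL2 (eta θ))), hshift] with x h1 h2 h3
  rw [h1, Pi.smul_apply, h2, h3, smul_eq_mul, ← mul_assoc, neg_mul, I_mul_I, neg_neg, one_mul]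

end InvertedEta

theorem proposition3p2 (lam : ℝ) (hlam : 0 < lam) :
    ((-Complex.I • opBlam lam (fourierL2.symm (eta 0)) : L2R) =ᵐ[volume] fun x : ℝ =>
      ((-√(8 / Real.pi) * Real.sign (x + 1 / lam) *
        kelvinKei (2 * √|x + 1 / lam|) : ℝ) : ℂ)) ∧
    ((-Complex.I • opBlam lam (fourierL2.symm (eta Real.pi)) : L2R) =ᵐ[volume] fun x : ℝ =>
      ((√(8 / Real.pi) * kelvinKer (2 * √|x + 1 / lam|) : ℝ) : ℂ)) :=
  ⟨coeFn_neg_I_smul_opBlam lam 0 coeFn_fourierL2_symm_inversionL2_eta_zero,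
    coeFn_neg_I_smul_opBlam lam Real.pi coeFn_fourierL2_symm_inversionL2_eta_pi⟩
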